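/- Let $\mathbb{K}$ be a field and let $R=\mathbb{K}[x_1,\dots,x_n]$ with its standard grading by total degree. For a homogeneous ideal $A\subseteq R$ let $\mathrm{pd}(R/A)$ be the projective dimension of the $R$-module $R/A$ (equal to $-\infty$ when $A=R$), let $\beta_{i,j}(R/A)=\dim_{\mathbb{K}}\mathrm{Tor}^R_i(R/A,\mathbb{K})_j$ be its graded Betti numbers, where $\mathbb{K}=R/(x_1,\dots,x_n)$, and let $\mathrm{reg}(R/A)=\sup\{\,j-i : \beta_{i,j}(R/A)\neq 0\,\}$ be its Castelnuovo–Mumford regularity. **Lemma.** Let $I$, $J$, $K$ be monomial ideals of $R$ with $I=J+K$, and let $q,r\ge 0$ be integers such that $$\mathrm{pd}(R/J)<q,\qquad \mathrm{pd}(R/K)=q,\qquad \mathrm{reg}(R/K)<r .$$ If $\mathrm{pd}(R/(J\cap K))=q$ and $\beta_{q,q+r}(R/(J\cap K))\neq 0$, then $\mathrm{pd}(R/I)=q+1$. -/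

import Mathlib

open MvPolynomial TensorProduct

universe u

noncomputable section

namespace MonomialSplitting

/-- The polynomial ring `R = 𝕜[x₁, …, xₙ]`, graded by total degree. -/
abbrev Poly (𝕜 : Type u) [Field 𝕜] (n : ℕ) : Type u := MvPolynomial (Fin n) 𝕜

/-- A monomial ideal: an ideal generated by monomials. -/
def IsMonomialIdeal {𝕜 : Type u} [Field 𝕜] {n : ℕ} (I : Ideal (Poly 𝕜 n)) : Prop :=
  ∃ S : Set (Fin n →₀ ℕ), I = Ideal.span ((fun m => monomial m (1 : 𝕜)) '' S)

/-- The degree `d` piece of `R/I`: the image of the homogeneous polynomials of degree `d`. -/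
def quotGrading {𝕜 : Type u} [Field 𝕜] {n : ℕ} (I : Ideal (Poly 𝕜 n)) (d : ℕ) :
    Submodule 𝕜 (Poly 𝕜 n ⧸ I) :=
  (homogeneousSubmodule (Fin n) 𝕜 d).map (Ideal.Quotient.mkₐ 𝕜 I).toLinearMap

/-- The degree `e` piece of the graded free module `⨁ₐ R(-deg a)`, whose basis vector indexed
by `a` sits in degree `deg a`. -/
def freeGrading {𝕜 : Type u} [Field 𝕜] {n : ℕ} {ι : Type u} (deg : ι → ℕ) (e : ℕ) :
    Submodule 𝕜 (ι →₀ Poly 𝕜 n) where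
  carrier := {x | ∀ a m, coeff m (x a) ≠ 0 → m.degree + deg a = e}
  zero_mem' := by simp
  add_mem' := by
    intro x y hx hy a m h
    by_cases h1 : coeff m (x a) = 0
    · refine hy a m ?_
      simpa [h1] using h
    · exact hx a m h1
  smul_mem' := by
    intro c x hx a m h
    refine hx a m ?_
    intro h0
    simp [h0] at h

/-- A graded free resolution `⋯ → F₂ → F₁ → F₀ → 𝕜 → 0` of the graded `R`-module
`𝕜 = R/(x₁, …, xₙ)`: `F p` is free on `ι p`, the basis vector `a` having degree `deg p a`, and
all maps are homogeneous of degree `0`. -/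
structure GradedFreeResolution (𝕜 : Type u) [Field 𝕜] (n : ℕ) where
  ι : ℕ → Type u
  deg : ∀ p, ι p → ℕ
  d : ∀ p, (ι (p + 1) →₀ Poly 𝕜 n) →ₗ[Poly 𝕜 n] (ι p →₀ Poly 𝕜 n)
  ε : (ι 0 →₀ Poly 𝕜 n) →ₗ[Poly 𝕜 n] (Poly 𝕜 n ⧸ idealOfVars (Fin n) 𝕜)
  d_homogeneous : ∀ p a, d p (Finsupp.single a 1) ∈ freeGrading (deg p) (deg (p + 1) a)
  ε_homogeneous : ∀ a, ε (Finsupp.single a 1) ∈ quotGrading (idealOfVars (Fin n) 𝕜) (deg 0 a)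
  ε_surjective : Function.Surjective ε
  exact_zero : Function.Exact (d 0) ε
  exact_succ : ∀ p, Function.Exact (d (p + 1)) (d p)

/-! Existence of a graded free resolution of `𝕜`. -/

/-- Projection of `⨁ₐ R(-deg a)` onto its degree `e` piece. -/
def freeComponent {𝕜 : Type u} [Field 𝕜] {n : ℕ} {ι : Type u} (deg : ι → ℕ) (e : ℕ) :
    (ι →₀ Poly 𝕜 n) →ₗ[𝕜] (ι →₀ Poly 𝕜 n) :=
  Finsupp.lsum 𝕜 fun a => (Finsupp.lsingle a).comp
    (if deg a ≤ e then homogeneousComponent (e - deg a) else 0)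

theorem coeff_freeComponent {𝕜 : Type u} [Field 𝕜] {n : ℕ} {ι : Type u} (deg : ι → ℕ) (e : ℕ)
    (x : ι →₀ Poly 𝕜 n) (a : ι) (m : Fin n →₀ ℕ) :
    coeff m (freeComponent deg e x a) = if m.degree + deg a = e then coeff m (x a) else 0 := by
  classical
  induction x using Finsupp.induction_linear with
  | zero => simp
  | add f g hf hg =>
    rw [map_add, Finsupp.add_apply, coeff_add, hf, hg, Finsupp.add_apply, coeff_add]
    split_ifs <;> simp
  | single b r =>
    simp only [freeComponent, Finsupp.lsum_single, LinearMap.comp_apply, Finsupp.lsingle_apply,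
      Finsupp.single_apply]
    by_cases hb : b = a
    · subst hb
      by_cases hd : deg b ≤ e
      · simp only [if_true, if_pos hd, coeff_homogeneousComponent]
        congr 1
        apply propext
        omega
      · have : ¬ (m.degree + deg b = e) := by omega
        simp [hd, this]
    · simp [hb]

theorem freeComponent_mem {𝕜 : Type u} [Field 𝕜] {n : ℕ} {ι : Type u} (deg : ι → ℕ) (e : ℕ)
    (x : ι →₀ Poly 𝕜 n) : freeComponent deg e x ∈ freeGrading deg e := by
  intro a m h
  rw [coeff_freeComponent] at h
  by_contra h'
  simp [h'] at h

theorem freeComponent_of_mem {𝕜 : Type u} [Field 𝕜] {n : ℕ} {ι : Type u} (deg : ι → ℕ) (e e' : ℕ)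
    (x : ι →₀ Poly 𝕜 n) (hx : x ∈ freeGrading deg e') :
    freeComponent deg e x = if e' = e then x else 0 := by
  ext a m
  rw [coeff_freeComponent]
  by_cases h0 : coeff m (x a) = 0
  · split_ifs <;> simp [h0]
  · have h := hx a m h0
    rw [h]
    split_ifs <;> simp

theorem smul_mem_freeGrading {𝕜 : Type u} [Field 𝕜] {n : ℕ} {ι : Type u} (deg : ι → ℕ) (e : ℕ)
    (x : ι →₀ Poly 𝕜 n) (hx : x ∈ freeGrading deg e) (m : Fin n →₀ ℕ) (c : 𝕜) :
    (monomial m c : Poly 𝕜 n) • x ∈ freeGrading deg (m.degree + e) := by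
  classical
  intro a k h
  rw [Finsupp.smul_apply, smul_eq_mul, coeff_monomial_mul'] at h
  split_ifs at h with hk
  · have := hx a (k - m) (right_ne_zero_of_mul h)
    obtain ⟨l, rfl⟩ := exists_add_of_le hk
    rw [add_tsub_cancel_left] at this
    rw [map_add, ← this, add_assoc]
  · exact absurd rfl h

theorem freeComponent_comm {𝕜 : Type u} [Field 𝕜] {n : ℕ} {ι ι' : Type u} (deg : ι → ℕ)
    (deg' : ι' → ℕ) (L : (ι' →₀ Poly 𝕜 n) →ₗ[Poly 𝕜 n] (ι →₀ Poly 𝕜 n))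
    (hL : ∀ a, L (Finsupp.single a 1) ∈ freeGrading deg (deg' a)) (e : ℕ) (f : ι' →₀ Poly 𝕜 n) :
    freeComponent deg e (L f) = L (freeComponent deg' e f) := by
  induction f using Finsupp.induction_linear with
  | zero => simp
  | add f g hf hg => simp only [map_add, hf, hg]
  | single a r =>
    induction r using MvPolynomial.induction_on' with
    | add p q hp hq => simp only [Finsupp.single_add, map_add, hp, hq]
    | monomial m c =>
      have h1 : (Finsupp.single a (monomial m c) : ι' →₀ Poly 𝕜 n)
          = (monomial m c : Poly 𝕜 n) • Finsupp.single a 1 := by simp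
      have h2 : (Finsupp.single a 1 : ι' →₀ Poly 𝕜 n) ∈ freeGrading deg' (deg' a) := by
        classical
        intro b k h
        rw [Finsupp.single_apply] at h
        split_ifs at h with hb
        · subst hb
          rw [coeff_one] at h
          split_ifs at h with hk
          · subst hk; simp
          · exact absurd rfl h
        · simp at h
      rw [h1, map_smul, freeComponent_of_mem _ _ _ _ (smul_mem_freeGrading _ _ _ (hL a) m c),
        freeComponent_of_mem _ _ _ _ (smul_mem_freeGrading _ _ _ h2 m c)]
      split_ifs
      · rw [map_smul]
      · rw [map_zero]

theorem exists_sum_freeComponent {𝕜 : Type u} [Field 𝕜] {n : ℕ} {ι : Type u} (deg : ι → ℕ)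
    (f : ι →₀ Poly 𝕜 n) :
    ∃ B, ∀ B' ≥ B, ∑ e ∈ Finset.range B', freeComponent deg e f = f := by
  induction f using Finsupp.induction_linear with
  | zero => exact ⟨0, by simp⟩
  | add f g hf hg =>
    obtain ⟨B, hB⟩ := hf
    obtain ⟨C, hC⟩ := hg
    refine ⟨max B C, fun B' h => ?_⟩
    simp only [map_add, Finset.sum_add_distrib]
    rw [hB B' (le_trans (le_max_left _ _) h), hC B' (le_trans (le_max_right _ _) h)]
  | single a r =>
    refine ⟨deg a + r.totalDegree + 1, fun B' h => ?_⟩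
    ext b m
    rw [Finsupp.finsetSum_apply, coeff_sum]
    simp only [coeff_freeComponent]
    rw [Finset.sum_ite_eq]
    split_ifs with hm
    · rfl
    · classical
      rw [Finsupp.single_apply]
      split_ifs with hb
      · subst hb
        symm
        by_contra h0
        have := le_totalDegree (mem_support_iff.2 h0)
        rw [Finset.mem_range] at hm
        have h3 : m.degree ≤ r.totalDegree := by
          rw [Finsupp.degree_apply]
          exact this
        omega
      · simp

/-- One stage of the resolution: a graded free module with a graded submodule. -/
structure Stage (𝕜 : Type u) [Field 𝕜] (n : ℕ) where
  ι : Type u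
  deg : ι → ℕ
  N : Submodule (Poly 𝕜 n) (ι →₀ Poly 𝕜 n)
  hN : ∀ x ∈ N, ∀ e, freeComponent deg e x ∈ N

/-- The map onto `N` from the free module on the homogeneous elements of `N`. -/
def Stage.map {𝕜 : Type u} [Field 𝕜] {n : ℕ} (s : Stage 𝕜 n) :
    ((Σ e : ℕ, {x // x ∈ s.N ∧ x ∈ freeGrading s.deg e}) →₀ Poly 𝕜 n) →ₗ[Poly 𝕜 n]
      (s.ι →₀ Poly 𝕜 n) :=
  Finsupp.linearCombination (Poly 𝕜 n) fun y => y.2.1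

theorem Stage.map_homogeneous {𝕜 : Type u} [Field 𝕜] {n : ℕ} (s : Stage 𝕜 n)
    (a : Σ e : ℕ, {x // x ∈ s.N ∧ x ∈ freeGrading s.deg e}) :
    s.map (Finsupp.single a 1) ∈ freeGrading s.deg a.1 := by
  simpa [Stage.map] using a.2.2.2

theorem Stage.range_map {𝕜 : Type u} [Field 𝕜] {n : ℕ} (s : Stage 𝕜 n) :
    LinearMap.range s.map = s.N := by
  apply le_antisymm
  · rw [Stage.map, Finsupp.range_linearCombination, Submodule.span_le]
    rintro _ ⟨y, rfl⟩
    exact y.2.2.1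
  · intro x hx
    obtain ⟨B, hB⟩ := exists_sum_freeComponent s.deg x
    rw [← hB B le_rfl]
    refine Submodule.sum_mem _ fun e _ => ?_
    refine ⟨Finsupp.single ⟨e, freeComponent s.deg e x, s.hN x hx e, freeComponent_mem _ _ _⟩ 1, ?_⟩
    simp [Stage.map]

/-- The next stage: the kernel of `s.map`. -/
def Stage.next {𝕜 : Type u} [Field 𝕜] {n : ℕ} (s : Stage 𝕜 n) : Stage 𝕜 n where
  ι := Σ e : ℕ, {x // x ∈ s.N ∧ x ∈ freeGrading s.deg e}
  deg := Sigma.fst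
  N := LinearMap.ker s.map
  hN := by
    intro x hx e
    rw [LinearMap.mem_ker] at hx ⊢
    rw [← freeComponent_comm s.deg Sigma.fst s.map s.map_homogeneous, hx, map_zero]

theorem mem_vars {𝕜 : Type u} [Field 𝕜] {n : ℕ} (f : Poly 𝕜 n) :
    f ∈ idealOfVars (Fin n) 𝕜 ↔ coeff 0 f = 0 := by
  rw [idealOfVars, ← Set.image_univ, mem_ideal_span_X_image]
  constructor
  · intro h
    by_contra h0
    obtain ⟨i, _, hi⟩ := h 0 (mem_support_iff.2 h0)
    simp at hi
  · intro h m hm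
    by_contra! h'
    have : m = 0 := by
      ext i
      simpa using h' i (Set.mem_univ i)
    subst this
    exact mem_support_iff.1 hm h

/-- The map `R → R/(x₁, …, xₙ)`. -/
def augmentation (𝕜 : Type u) [Field 𝕜] (n : ℕ) :
    (PUnit.{u + 1} →₀ Poly 𝕜 n) →ₗ[Poly 𝕜 n] (Poly 𝕜 n ⧸ idealOfVars (Fin n) 𝕜) :=
  (Submodule.mkQ (idealOfVars (Fin n) 𝕜)).comp (Finsupp.lapply PUnit.unit)

/-- The initial stage: `(x₁, …, xₙ) ⊆ R`. -/
def Stage.init (𝕜 : Type u) [Field 𝕜] (n : ℕ) : Stage 𝕜 n where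
  ι := PUnit.{u + 1}
  deg := fun _ => 0
  N := LinearMap.ker (augmentation 𝕜 n)
  hN := by
    intro x hx e
    rw [LinearMap.mem_ker, augmentation, LinearMap.comp_apply, Submodule.mkQ_apply,
      Submodule.Quotient.mk_eq_zero, Finsupp.lapply_apply, mem_vars] at hx ⊢
    rw [coeff_freeComponent, hx]
    simp

theorem augmentation_single {𝕜 : Type u} [Field 𝕜] {n : ℕ} (r : Poly 𝕜 n) :
    augmentation 𝕜 n (Finsupp.single PUnit.unit r) = Ideal.Quotient.mk _ r := by
  rw [augmentation, LinearMap.comp_apply, Finsupp.lapply_apply, Finsupp.single_eq_same]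
  rfl

theorem Stage.exact_next {𝕜 : Type u} [Field 𝕜] {n : ℕ} (s : Stage 𝕜 n) :
    Function.Exact s.next.map s.map :=
  LinearMap.exact_iff.2 (Stage.range_map s.next).symm

theorem Stage.exact_init (𝕜 : Type u) [Field 𝕜] (n : ℕ) :
    Function.Exact (Stage.init 𝕜 n).map (augmentation 𝕜 n) :=
  LinearMap.exact_iff.2 (Stage.range_map (Stage.init 𝕜 n)).symm

instance (𝕜 : Type u) [Field 𝕜] (n : ℕ) : Nonempty (GradedFreeResolution 𝕜 n) := by
  let s : ℕ → Stage 𝕜 n := fun p => Nat.rec (Stage.init 𝕜 n) (fun _ t => t.next) p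
  refine ⟨{
    ι := fun p => (s p).ι
    deg := fun p => (s p).deg
    d := fun p => (s p).map
    ε := augmentation 𝕜 n
    d_homogeneous := fun p a => (s p).map_homogeneous a
    ε_homogeneous := fun a => ⟨1, isHomogeneous_one _ _, ?_⟩
    ε_surjective := ?_
    exact_zero := ?_
    exact_succ := fun p => ?_ }⟩
  · exact (augmentation_single 1).symm
  · intro y
    obtain ⟨r, rfl⟩ := Ideal.Quotient.mk_surjective y
    exact ⟨Finsupp.single PUnit.unit r, augmentation_single r⟩
  · exact Stage.exact_init 𝕜 n
  · exact Stage.exact_next (s p)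

/-- A graded free resolution of `𝕜`. -/
def residueResolution (𝕜 : Type u) [Field 𝕜] (n : ℕ) : GradedFreeResolution 𝕜 n :=
  Classical.choice inferInstance

/-! Graded `Tor`, Betti numbers and regularity of a graded module `M` with graded pieces
`𝓜 0, 𝓜 1, …`. -/

section Tor

variable {𝕜 : Type u} [Field 𝕜] {n : ℕ} (M : Type u) [AddCommGroup M] [Module (Poly 𝕜 n) M]

/-- The `p`-th term of the complex `M ⊗ F`, where `F` is the graded free resolution of `𝕜`. -/
abbrev TorChain (p : ℕ) : Type u :=
  M ⊗[Poly 𝕜 n] ((residueResolution 𝕜 n).ι p →₀ Poly 𝕜 n)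

/-- The differential of `M ⊗ F`. -/
def torD (p : ℕ) : TorChain (𝕜 := 𝕜) (n := n) M (p + 1) →ₗ[Poly 𝕜 n] TorChain (𝕜 := 𝕜) (n := n) M p :=
  LinearMap.lTensor M ((residueResolution 𝕜 n).d p)

/-- The cycles of `M ⊗ F`; in homological degree `0` every chain is a cycle. -/
def torCycles : ∀ p : ℕ, Submodule (Poly 𝕜 n) (TorChain (𝕜 := 𝕜) (n := n) M p)
  | 0 => ⊤
  | p + 1 => LinearMap.ker (torD M p)

/-- `Tor_p^R(M, 𝕜)`, the `p`-th homology of `M ⊗ F`. -/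
abbrev GradedTor (p : ℕ) : Type u :=
  ↥(torCycles (𝕜 := 𝕜) (n := n) M p) ⧸
    (LinearMap.range (torD (𝕜 := 𝕜) (n := n) M p)).submoduleOf (torCycles M p)

variable {M} [Module 𝕜 M] [IsScalarTower 𝕜 (Poly 𝕜 n) M] (𝓜 : ℕ → Submodule 𝕜 M)

/-- The degree `j` piece of `M ⊗ F_p`: it is spanned by the `m ⊗ a` with `m` homogeneous, `a` a
basis vector of `F_p` and `deg m + deg a = j`. -/
def torChainGrading (p j : ℕ) : Submodule 𝕜 (TorChain (𝕜 := 𝕜) (n := n) M p) :=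
  Submodule.span 𝕜 {t | ∃ (s : ℕ) (m : M) (a : (residueResolution 𝕜 n).ι p),
    m ∈ 𝓜 s ∧ s + (residueResolution 𝕜 n).deg p a = j ∧ t = m ⊗ₜ Finsupp.single a 1}

/-- The degree `j` piece `Tor_p^R(M, 𝕜)_j`: the classes of the cycles of degree `j`. -/
def torGrading (p j : ℕ) : Submodule 𝕜 (GradedTor (𝕜 := 𝕜) (n := n) M p) :=
  ((torChainGrading 𝓜 p j).comap ((torCycles M p).subtype.restrictScalars 𝕜)).map
    ((Submodule.mkQ ((LinearMap.range (torD (𝕜 := 𝕜) (n := n) M p)).submoduleOf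
      (torCycles M p))).restrictScalars 𝕜)

/-- The graded Betti number `β_{i,j}(M) = dim_𝕜 Tor_i^R(M, 𝕜)_j`. -/
def gradedBetti (i j : ℕ) : ℕ∞ :=
  Cardinal.toENat (Module.rank 𝕜 (torGrading (n := n) 𝓜 i j))

/-- The Castelnuovo–Mumford regularity `reg M = sup {j - i : β_{i,j}(M) ≠ 0}`, which is `-∞`
when there is no nonzero Betti number. -/
def regularity : WithBot (WithTop ℤ) :=
  sSup {t | ∃ i j : ℕ, gradedBetti (n := n) 𝓜 i j ≠ 0 ∧
    t = (((j : ℤ) - (i : ℤ) : ℤ) : WithBot (WithTop ℤ))}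

end Tor

section Quotient

variable {𝕜 : Type u} [Field 𝕜] {n : ℕ}

/-- `pd_R(R/I)`; it is `⊥` when `R/I = 0`. -/
def pdQuot (I : Ideal (Poly 𝕜 n)) : WithBot ℕ∞ :=
  CategoryTheory.projectiveDimension (ModuleCat.of (Poly 𝕜 n) (Poly 𝕜 n ⧸ I))

/-- `β_{i,j}(R/I)`. -/
def bettiQuot (I : Ideal (Poly 𝕜 n)) (i j : ℕ) : ℕ∞ :=
  gradedBetti (n := n) (quotGrading I) i j

/-- `reg(R/I)`. -/
def regQuot (I : Ideal (Poly 𝕜 n)) : WithBot (WithTop ℤ) :=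
  regularity (n := n) (quotGrading I)

end Quotient

end MonomialSplitting

end

/-! Everything comes from the Mayer–Vietoris sequence 0 → R/(J ∩ K) → R/J × R/K → R/(J + K) → 0. Its
end terms and middle term bound pd(R/I) above by q + 1 (`hasProjectiveDimensionLT_quot_sup`). For
the lower bound, suppose pd(R/I) ≤ q. Then Tor_{q+1}(R/I, 𝕜) = 0, so Tor_q(R/(J ∩ K), 𝕜) injects
into Tor_q(R/J, 𝕜) ⊕ Tor_q(R/K, 𝕜). The first summand vanishes since pd(R/J) < q, and the second
vanishes in degree q + r since reg(R/K) < r. As the maps preserve degree, β_{q,q+r}(R/(J ∩ K)) = 0,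
a contradiction (`not_hasProjectiveDimensionLT_quot_sup`). Tor is the homology of M ⊗ F for a fixed
resolution F of 𝕜, so the needed pieces of its long exact sequence are diagram chases on chains. -/

namespace MonomialSplitting

/-! ### Homology of M ⊗ F and its long exact sequence -/

section TorVanishing

variable {𝕜 : Type u} [Field 𝕜] {n : ℕ}

/-- The homology of `M ⊗ F` vanishes in homological degree `p`. -/
def TorVanishes (𝕜 : Type u) [Field 𝕜] (n : ℕ) (M : Type u) [AddCommGroup M]
    [Module (Poly 𝕜 n) M] (p : ℕ) : Prop :=
  torCycles (𝕜 := 𝕜) (n := n) M p ≤ LinearMap.range (torD M p)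

/-- The map `M ⊗ F_p → N ⊗ F_p` induced by a linear map `M → N`. -/
noncomputable abbrev torMap {M N : Type u} [AddCommGroup M] [Module (Poly 𝕜 n) M] [AddCommGroup N]
    [Module (Poly 𝕜 n) N] (f : M →ₗ[Poly 𝕜 n] N) (p : ℕ) :
    TorChain (𝕜 := 𝕜) (n := n) M p →ₗ[Poly 𝕜 n] TorChain (𝕜 := 𝕜) (n := n) N p :=
  LinearMap.rTensor _ f

variable {M₁ M₂ M₃ : Type u} [AddCommGroup M₁] [Module (Poly 𝕜 n) M₁] [AddCommGroup M₂]
  [Module (Poly 𝕜 n) M₂] [AddCommGroup M₃] [Module (Poly 𝕜 n) M₃]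

theorem torMap_torD (f : M₁ →ₗ[Poly 𝕜 n] M₂) (p : ℕ)
    (x : TorChain (𝕜 := 𝕜) (n := n) M₁ (p + 1)) :
    torMap f p (torD M₁ p x) = torD M₂ p (torMap f (p + 1) x) := by
  simp only [torMap, torD, ← LinearMap.comp_apply, LinearMap.rTensor_comp_lTensor,
    LinearMap.lTensor_comp_rTensor]

theorem torD_torD (p : ℕ) (x : TorChain (𝕜 := 𝕜) (n := n) M₁ (p + 2)) :
    torD M₁ p (torD M₁ (p + 1) x) = 0 := by
  rw [torD, torD, ← LinearMap.comp_apply, ← LinearMap.lTensor_comp,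
    ((residueResolution 𝕜 n).exact_succ p).linearMap_comp_eq_zero, LinearMap.lTensor_zero,
    LinearMap.zero_apply]

theorem torVanishes_of_flat [Module.Flat (Poly 𝕜 n) M₁] (p : ℕ) :
    TorVanishes 𝕜 n M₁ (p + 1) := fun z hz =>
  (Module.Flat.lTensor_exact M₁ ((residueResolution 𝕜 n).exact_succ p) z).1 hz

theorem torVanishes_of_subsingleton [Subsingleton M₁] (p : ℕ) : TorVanishes 𝕜 n M₁ p :=
  fun z _ => by
    have : Subsingleton (TorChain (𝕜 := 𝕜) (n := n) M₁ p) := inferInstance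
    rw [Subsingleton.elim z 0]
    exact zero_mem _

variable {f : M₁ →ₗ[Poly 𝕜 n] M₂} {g : M₂ →ₗ[Poly 𝕜 n] M₃}

theorem torMap_injective (hf : Function.Injective f) (p : ℕ) :
    Function.Injective (torMap f p) :=
  Module.Flat.rTensor_preserves_injective_linearMap f hf

/-- A piece of the long exact sequence: `Tor_{p+1}(M₃) = 0` if `Tor_{p+1}(M₂) = 0` and
`Tor_p(M₁) = 0`. -/
theorem TorVanishes.of_exact (hf : Function.Injective f) (hfg : Function.Exact f g)
    (hg : Function.Surjective g) {p : ℕ} (h₁ : TorVanishes 𝕜 n M₁ p)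
    (h₂ : TorVanishes 𝕜 n M₂ (p + 1)) : TorVanishes 𝕜 n M₃ (p + 1) := by
  intro z hz
  replace hz : torD M₃ p z = 0 := hz
  obtain ⟨y, rfl⟩ := LinearMap.rTensor_surjective _ hg z
  rw [← torMap_torD] at hz
  obtain ⟨x, hx⟩ := (rTensor_exact _ hfg hg _).1 hz
  -- In degree 0 every chain is a cycle. Above that, F_p is free, so M₁ ⊗ F_p embeds in M₂ ⊗ F_p,
  -- where the boundary of x becomes ddy = 0.
  have hxc : x ∈ torCycles (𝕜 := 𝕜) (n := n) M₁ p := by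
    cases p with
    | zero => trivial
    | succ p =>
      refine torMap_injective hf p ?_
      rw [map_zero, torMap_torD, torMap, hx, torD_torD]
  obtain ⟨w, rfl⟩ := h₁ hxc
  have hc : y - torMap f (p + 1) w ∈ torCycles (𝕜 := 𝕜) (n := n) M₂ (p + 1) := by
    change torD M₂ p _ = 0
    rw [map_sub, ← torMap_torD, torMap, hx, sub_self]
  obtain ⟨v, hv⟩ := h₂ hc
  refine ⟨torMap g _ v, ?_⟩
  rw [← torMap_torD, hv, map_sub,
    (rTensor_exact _ hfg hg).apply_apply_eq_zero w, sub_zero]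

/-- A piece of the long exact sequence: `Tor_p(M₁) → Tor_p(M₂)` is injective if
`Tor_{p+1}(M₃) = 0`. -/
theorem mem_range_torD_of_exact (hf : Function.Injective f) (hfg : Function.Exact f g)
    (hg : Function.Surjective g) {p : ℕ} (h₃ : TorVanishes 𝕜 n M₃ (p + 1))
    {z : TorChain (𝕜 := 𝕜) (n := n) M₁ p}
    (hz : torMap f p z ∈ LinearMap.range (torD (𝕜 := 𝕜) (n := n) M₂ p)) :
    z ∈ LinearMap.range (torD (𝕜 := 𝕜) (n := n) M₁ p) := by
  obtain ⟨b, hb⟩ := hz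
  have hc : torMap g (p + 1) b ∈ torCycles (𝕜 := 𝕜) (n := n) M₃ (p + 1) := by
    change torD M₃ p _ = 0
    rw [← torMap_torD, hb, (rTensor_exact _ hfg hg).apply_apply_eq_zero]
  obtain ⟨c, hc⟩ := h₃ hc
  obtain ⟨c, rfl⟩ := LinearMap.rTensor_surjective _ hg c
  rw [← torMap_torD, ← sub_eq_zero, ← map_sub] at hc
  obtain ⟨a, ha⟩ := (rTensor_exact _ hfg hg _).1 hc
  -- Here a maps to dc − b, and applying d leaves −db; hence the sign.
  refine ⟨-a, torMap_injective hf p ?_⟩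
  rw [torMap_torD, map_neg, torMap, ha, map_neg, map_sub, torD_torD, zero_sub, neg_neg, hb]

/-- `Tor_p(M)` vanishes for `p` at least any strict bound of the projective dimension. -/
theorem torVanishes_of_hasProjectiveDimensionLT (p : ℕ) :
    ∀ (M : Type u) [AddCommGroup M] [Module (Poly 𝕜 n) M],
      CategoryTheory.HasProjectiveDimensionLT (ModuleCat.of (Poly 𝕜 n) M) p →
        TorVanishes 𝕜 n M p := by
  induction p with
  | zero =>
    intro M _ _ h
    have := ModuleCat.subsingleton_of_isZero
      (CategoryTheory.hasProjectiveDimensionLT_zero_iff_isZero _ |>.1 h)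
    have : Subsingleton M := this
    exact torVanishes_of_subsingleton 0
  | succ p ih =>
    intro M _ _ h
    -- Projective modules are treated apart: the kernel of a free cover of one is projective but
    -- need not be zero, so dimension shifting starts only at pd < 2.
    obtain _ | p := p
    · have : Module.Projective (Poly 𝕜 n) M := (IsProjective.iff_projective _).2
        (CategoryTheory.projective_iff_hasProjectiveDimensionLT_one.2 h)
      exact torVanishes_of_flat 0
    · let e := Finsupp.linearCombination (Poly 𝕜 n) (id : M → M)
      have he : Function.Surjective e := Finsupp.linearCombination_id_surjective _ _
      have hF : CategoryTheory.Projective (ModuleCat.of (Poly 𝕜 n) (M →₀ Poly 𝕜 n)) :=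
        (IsProjective.iff_projective _).1 inferInstance
      have hker := ih (LinearMap.ker e)
        (((LinearMap.shortExact_shortComplexKer he).hasProjectiveDimensionLT_X₃_iff p hF).1 h)
      exact hker.of_exact (Submodule.subtype_injective _) (LinearMap.exact_subtype_ker_map e) he
        (torVanishes_of_flat (p + 1))

/-- The identity of M₁ × M₂ is inl ∘ fst + inr ∘ snd, so bounding chains for the two components add
up to one for z. -/
theorem mem_range_torD_prod {p : ℕ} {z : TorChain (𝕜 := 𝕜) (n := n) (M₁ × M₂) p}
    (h₁ : torMap (LinearMap.fst _ M₁ M₂) p z ∈ LinearMap.range (torD (𝕜 := 𝕜) (n := n) M₁ p))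
    (h₂ : torMap (LinearMap.snd _ M₁ M₂) p z ∈ LinearMap.range (torD (𝕜 := 𝕜) (n := n) M₂ p)) :
    z ∈ LinearMap.range (torD (𝕜 := 𝕜) (n := n) (M₁ × M₂) p) := by
  obtain ⟨x, hx⟩ := h₁
  obtain ⟨y, hy⟩ := h₂
  refine ⟨torMap (LinearMap.inl _ M₁ M₂) _ x + torMap (LinearMap.inr _ M₁ M₂) _ y, ?_⟩
  rw [map_add, ← torMap_torD, ← torMap_torD, hx, hy, torMap, torMap, torMap, torMap,
    ← LinearMap.rTensor_comp_apply, ← LinearMap.rTensor_comp_apply, ← LinearMap.add_apply,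
    ← LinearMap.rTensor_add]
  convert LinearMap.rTensor_id_apply _ _ z
  ext <;> simp

theorem torMap_mem_torCycles (f : M₁ →ₗ[Poly 𝕜 n] M₂) {p : ℕ}
    {z : TorChain (𝕜 := 𝕜) (n := n) M₁ p} (hz : z ∈ torCycles (𝕜 := 𝕜) (n := n) M₁ p) :
    torMap f p z ∈ torCycles (𝕜 := 𝕜) (n := n) M₂ p := by
  cases p with
  | zero => trivial
  | succ p =>
    replace hz : torD M₁ p z = 0 := hz
    change torD M₂ p _ = 0
    rw [← torMap_torD, hz, map_zero]

/-! ### Degrees, Betti numbers and regularity -/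

section Graded

variable [Module 𝕜 M₁] [IsScalarTower 𝕜 (Poly 𝕜 n) M₁] [Module 𝕜 M₂]
  [IsScalarTower 𝕜 (Poly 𝕜 n) M₂]

theorem torMap_mem_torChainGrading {𝓜 : ℕ → Submodule 𝕜 M₁} {𝓝 : ℕ → Submodule 𝕜 M₂}
    (f : M₁ →ₗ[Poly 𝕜 n] M₂) (hf : ∀ s, ∀ m ∈ 𝓜 s, f m ∈ 𝓝 s) {p j : ℕ}
    {z : TorChain (𝕜 := 𝕜) (n := n) M₁ p} (hz : z ∈ torChainGrading 𝓜 p j) :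
    torMap f p z ∈ torChainGrading 𝓝 p j := by
  have h : torChainGrading 𝓜 p j ≤
      (torChainGrading 𝓝 p j).comap ((torMap f p).restrictScalars 𝕜) := by
    refine Submodule.span_le.2 ?_
    rintro _ ⟨s, m, a, hm, hs, rfl⟩
    exact Submodule.subset_span ⟨s, f m, a, hf s m hm, hs, rfl⟩
  exact h hz

/-- `β_{p,j} = 0` means that every cycle of degree `j` is a boundary. -/
theorem gradedBetti_eq_zero_iff (𝓜 : ℕ → Submodule 𝕜 M₁) (p j : ℕ) :
    gradedBetti (n := n) 𝓜 p j = 0 ↔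
      ∀ z ∈ torCycles (𝕜 := 𝕜) (n := n) M₁ p, z ∈ torChainGrading 𝓜 p j →
        z ∈ LinearMap.range (torD (𝕜 := 𝕜) (n := n) M₁ p) := by
  rw [gradedBetti, Cardinal.toENat_eq_zero, rank_zero_iff, Submodule.subsingleton_iff_eq_bot,
    torGrading, ← le_bot_iff, Submodule.map_le_iff_le_comap]
  constructor
  · intro h z hz hzj
    have h0 : Submodule.Quotient.mk (p := (LinearMap.range
        (torD (𝕜 := 𝕜) (n := n) M₁ p)).submoduleOf (torCycles M₁ p)) ⟨z, hz⟩ = 0 :=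
      h (x := ⟨z, hz⟩) hzj
    rw [Submodule.Quotient.mk_eq_zero] at h0
    exact h0
  · intro h z hz
    exact (Submodule.Quotient.mk_eq_zero _).2 (h z.1 z.2 hz)

/-- Otherwise j − i ≥ r would belong to the set whose supremum is the regularity. -/
theorem gradedBetti_eq_zero_of_regularity_lt {𝓜 : ℕ → Submodule 𝕜 M₁} {r : ℤ}
    (h : regularity (n := n) 𝓜 < ((r : WithTop ℤ) : WithBot (WithTop ℤ))) {i j : ℕ}
    (hij : r ≤ (j : ℤ) - i) : gradedBetti (n := n) 𝓜 i j = 0 := by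
  by_contra hne
  have hle : ((((j : ℤ) - (i : ℤ) : ℤ) : WithTop ℤ) : WithBot (WithTop ℤ)) ≤
      regularity (n := n) 𝓜 := le_sSup ⟨i, j, hne, rfl⟩
  have h' := hle.trans_lt h
  rw [WithBot.coe_lt_coe, WithTop.coe_lt_coe] at h'
  omega

end Graded

theorem factor_mem_quotGrading {A B : Ideal (Poly 𝕜 n)} (h : A ≤ B) (s : ℕ) (m : Poly 𝕜 n ⧸ A)
    (hm : m ∈ quotGrading A s) : Submodule.factor h m ∈ quotGrading B s := by
  obtain ⟨x, hx, rfl⟩ := hm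
  exact ⟨x, hx, rfl⟩

end TorVanishing

/-! ### The Mayer–Vietoris sequence of two ideals -/

section MayerVietoris

variable {A : Type u} [CommRing A] (J K : Ideal A)

/-- The map `A/(J ∩ K) → A/J × A/K`. -/
noncomputable def quotInfToProd : (A ⧸ J ⊓ K) →ₗ[A] (A ⧸ J) × (A ⧸ K) :=
  (Submodule.factor inf_le_left).prod (Submodule.factor inf_le_right)

/-- The difference map `A/J × A/K → A/(J + K)`. -/
noncomputable def prodToQuotSup : ((A ⧸ J) × (A ⧸ K)) →ₗ[A] A ⧸ J ⊔ K :=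
  (Submodule.factor le_sup_left).coprod (-Submodule.factor le_sup_right)

theorem quotInfToProd_injective : Function.Injective (quotInfToProd J K) := by
  rw [injective_iff_map_eq_zero]
  intro x hx
  obtain ⟨x, rfl⟩ := Submodule.mkQ_surjective _ x
  obtain ⟨h₁, h₂⟩ := Prod.ext_iff.1 hx
  exact (Submodule.Quotient.mk_eq_zero _).2
    ⟨(Submodule.Quotient.mk_eq_zero _).1 h₁, (Submodule.Quotient.mk_eq_zero _).1 h₂⟩

theorem prodToQuotSup_surjective : Function.Surjective (prodToQuotSup J K) := by
  intro x
  obtain ⟨x, rfl⟩ := Submodule.mkQ_surjective _ x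
  exact ⟨(Submodule.mkQ J x, 0), by simp [prodToQuotSup]⟩

theorem exact_quotInfToProd_prodToQuotSup :
    Function.Exact (quotInfToProd J K) (prodToQuotSup J K) := by
  rintro ⟨x, y⟩
  obtain ⟨x, rfl⟩ := Submodule.mkQ_surjective _ x
  obtain ⟨y, rfl⟩ := Submodule.mkQ_surjective _ y
  constructor
  · intro h
    have h' : x - y ∈ J ⊔ K := by
      rw [← Submodule.Quotient.mk_eq_zero, Submodule.Quotient.mk_sub, sub_eq_add_neg]
      exact h
    obtain ⟨a, ha, b, hb, hab⟩ := Submodule.mem_sup.1 h'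
    -- Since x − y = a + b with a ∈ J and b ∈ K, the element x − a = y + b is congruent to x mod J
    -- and to y mod K.
    refine ⟨Submodule.mkQ _ (x - a), Prod.ext ?_ ?_⟩
    · refine (Submodule.Quotient.eq J).2 ?_
      simpa using ha
    · refine (Submodule.Quotient.eq K).2 ?_
      have : x - a - y = b := by linear_combination -hab
      change x - a - y ∈ K
      rwa [this]
  · rintro ⟨z, hz⟩
    obtain ⟨z, rfl⟩ := Submodule.mkQ_surjective _ z
    rw [← hz]
    simp [quotInfToProd, prodToQuotSup]

open CategoryTheory

/-- The product is an extension of N by M, and the bound passes to the middle term. -/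
theorem hasProjectiveDimensionLT_prod (M N : Type u) [AddCommGroup M] [Module A M]
    [AddCommGroup N] [Module A N] (m : ℕ) (hM : HasProjectiveDimensionLT (ModuleCat.of A M) m)
    (hN : HasProjectiveDimensionLT (ModuleCat.of A N) m) :
    HasProjectiveDimensionLT (ModuleCat.of A (M × N)) m :=
  (ModuleCat.shortComplex_shortExact
    (ModuleCat.shortComplexOfCompEqZero (LinearMap.inl A M N) (LinearMap.snd A M N)
      (LinearMap.snd_comp_inl A M N))
    Function.Exact.inl_snd LinearMap.inl_injective
    LinearMap.snd_surjective).hasProjectiveDimensionLT_X₂ m hM hN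

theorem hasProjectiveDimensionLT_quot_sup (m : ℕ)
    (hJK : HasProjectiveDimensionLT (ModuleCat.of A (A ⧸ J ⊓ K)) m)
    (hJ : HasProjectiveDimensionLT (ModuleCat.of A (A ⧸ J)) (m + 1))
    (hK : HasProjectiveDimensionLT (ModuleCat.of A (A ⧸ K)) (m + 1)) :
    HasProjectiveDimensionLT (ModuleCat.of A (A ⧸ J ⊔ K)) (m + 1) :=
  (ModuleCat.shortComplex_shortExact
    (ModuleCat.shortComplexOfCompEqZero (quotInfToProd J K) (prodToQuotSup J K)
      (exact_quotInfToProd_prodToQuotSup J K).linearMap_comp_eq_zero)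
    (exact_quotInfToProd_prodToQuotSup J K) (quotInfToProd_injective J K)
    (prodToQuotSup_surjective J K)).hasProjectiveDimensionLT_X₃ m hJK
      (hasProjectiveDimensionLT_prod _ _ _ hJ hK)

end MayerVietoris

/-- It suffices to bound each degree-j cycle of R/(J ∩ K): by injectivity on Tor_q, this can be
checked after projecting to R/J and to R/K. -/
theorem not_hasProjectiveDimensionLT_quot_sup {𝕜 : Type u} [Field 𝕜] {n : ℕ}
    (J K : Ideal (Poly 𝕜 n)) {q j : ℕ}
    (hJ : CategoryTheory.HasProjectiveDimensionLT (ModuleCat.of (Poly 𝕜 n) (Poly 𝕜 n ⧸ J)) q)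
    (hK : bettiQuot K q j = 0) (hJK : bettiQuot (J ⊓ K) q j ≠ 0) :
    ¬ CategoryTheory.HasProjectiveDimensionLT
      (ModuleCat.of (Poly 𝕜 n) (Poly 𝕜 n ⧸ J ⊔ K)) (q + 1) := by
  intro h
  refine hJK ((gradedBetti_eq_zero_iff _ _ _).2 fun z hz hzj => ?_)
  refine mem_range_torD_of_exact (quotInfToProd_injective J K)
    (exact_quotInfToProd_prodToQuotSup J K) (prodToQuotSup_surjective J K)
    (torVanishes_of_hasProjectiveDimensionLT _ _ h) (mem_range_torD_prod ?_ ?_)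
  · exact torVanishes_of_hasProjectiveDimensionLT _ _ hJ
      (torMap_mem_torCycles _ (torMap_mem_torCycles _ hz))
  · refine (gradedBetti_eq_zero_iff _ _ _).1 hK _
      (torMap_mem_torCycles _ (torMap_mem_torCycles _ hz)) ?_
    -- The composite is the natural quotient map to R/K, which preserves degree, so the image cycle
    -- still lies in degree j.
    rw [torMap, torMap, ← LinearMap.rTensor_comp_apply]
    exact torMap_mem_torChainGrading _ (factor_mem_quotGrading inf_le_right) hzj

end MonomialSplitting

theorem mainTheorem6 {𝕜 : Type u} [Field 𝕜] {n : ℕ}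
    (I J K : Ideal (MonomialSplitting.Poly 𝕜 n))
    (hI : MonomialSplitting.IsMonomialIdeal I)
    (hJ : MonomialSplitting.IsMonomialIdeal J)
    (hK : MonomialSplitting.IsMonomialIdeal K)
    (hIJK : I = J + K) (q r : ℕ)
    (hpdJ : MonomialSplitting.pdQuot J < (q : WithBot ℕ∞))
    (hpdK : MonomialSplitting.pdQuot K = (q : WithBot ℕ∞))
    (hreg : MonomialSplitting.regQuot K < (((r : ℤ) : WithTop ℤ) : WithBot (WithTop ℤ)))
    (hpdJK : MonomialSplitting.pdQuot (J ⊓ K) = (q : WithBot ℕ∞))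
    (hbetti : MonomialSplitting.bettiQuot (J ⊓ K) q (q + r) ≠ 0) :
    MonomialSplitting.pdQuot I = ((q + 1 : ℕ) : WithBot ℕ∞) := by
  subst hIJK
  have hJ' := CategoryTheory.projectiveDimension_lt_iff.1 hpdJ
  have hK' := (CategoryTheory.projectiveDimension_le_iff _ _).1 hpdK.le
  apply le_antisymm
  · exact (CategoryTheory.projectiveDimension_le_iff _ _).2
      (MonomialSplitting.hasProjectiveDimensionLT_quot_sup J K (q + 1)
        ((CategoryTheory.projectiveDimension_le_iff _ _).1 hpdJK.le)
        (CategoryTheory.hasProjectiveDimensionLT_of_ge _ q _ (by omega))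
        (CategoryTheory.hasProjectiveDimensionLT_of_ge _ (q + 1) _ (by omega)))
  · exact (CategoryTheory.projectiveDimension_ge_iff _ _).2
      (MonomialSplitting.not_hasProjectiveDimensionLT_quot_sup J K hJ'
        -- With i = q and j = q + r, the required r ≤ j − i holds with equality.
        (MonomialSplitting.gradedBetti_eq_zero_of_regularity_lt hreg (by push_cast; omega))
        hbetti)
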